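/- Let $W$ be Lambert's function, the inverse of $x\mapsto xe^x$ on $[0,\infty)$, and let $\mu_*$ be the probability measure on $[0,\infty)$ with $\mu_*((y,\infty))=W(1)e^{-y}$ for all $y\ge 0$. Let $\mathcal V$ be the set of finite words over $\{1,2,3,\dots\}$, with root the empty word $\phi$; $|v|$ is the length of $v$, and $v.j$ is $v$ followed by the letter $j$. The invariant recursive tree process with marginal $\mu_*$ associated with the edge-cover recursive distributional equation $X\overset{d}{=}\min_{j\ge1}(\xi_j-X_j)^+$ is a family $(\xi^v,X_v)_{v\in\mathcal V}$ on a probability space such that - the sequences $\xi^v=(\xi^v_j)_{j\ge1}$, $v\in\mathcal V$, are independent, and each one lists in increasing order the points of a Poisson process of rate $1$ on $[0,\infty)$; - for every $v\in\mathcal V$, almost surely $X_v=\min_{j\ge1}(\xi^v_j-X_{v.j})^+$; - for every $d\ge0$, the variables $X_v$, $|v|=d$, are i.i.d. with law $\mu_*$, and the family $(X_v)_{|v|=d}$ is independent of $(\xi^u)_{|u|<d}$. Theorem. Such a process exists, and every such process is endogenous: the root variable $X_\phi$ is almost surely equal to a random variable that is measurable with respect to the $\sigma$-algebra $\sigma(\xi^v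 : v\in\mathcal V)$. -/

import Mathlib

open MeasureTheory ProbabilityTheory
open scoped NNReal ENNReal

namespace EdgeCover

noncomputable section

/-- The Lambert function `W`: the inverse of `x ↦ x * exp x` on `[0, ∞)`. -/
def lambertW : ℝ → ℝ :=
  Function.invFunOn (fun x : ℝ => x * Real.exp x) (Set.Ici 0)

theorem lambertW_spec {y : ℝ} (hy : 0 ≤ y) :
    0 ≤ lambertW y ∧ lambertW y * Real.exp (lambertW y) = y := by
  have h : ∃ x ∈ Set.Ici (0 : ℝ), (fun x : ℝ => x * Real.exp x) x = y := by
    have hc : ContinuousOn (fun x : ℝ => x * Real.exp x) (Set.Icc 0 y) := by fun_prop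
    have hmem : y ∈ Set.Icc ((fun x : ℝ => x * Real.exp x) 0)
        ((fun x : ℝ => x * Real.exp x) y) := by
      refine ⟨by simpa using hy, ?_⟩
      have h1 : (1 : ℝ) ≤ Real.exp y := Real.one_le_exp hy
      show y ≤ y * Real.exp y
      nlinarith
    obtain ⟨x, hx, hxy⟩ := intermediate_value_Icc hy hc hmem
    exact ⟨x, hx.1, hxy⟩
  exact ⟨Function.invFunOn_mem h, Function.invFunOn_eq h⟩

theorem lambertW_one_le_one : lambertW 1 ≤ 1 := by
  obtain ⟨h0, h1⟩ := lambertW_spec (zero_le_one : (0 : ℝ) ≤ 1)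
  have h2 : (1 : ℝ) ≤ Real.exp (lambertW 1) := Real.one_le_exp h0
  nlinarith

/-- The law `μ_*` on `[0, ∞)` with `μ_* (y, ∞) = W(1) * exp (-y)` for `y ≥ 0`: an atom of mass
`1 - W(1)` at `0`, plus `W(1)` times the standard exponential law. -/
def muStar : Measure ℝ≥0 :=
  ENNReal.ofReal (1 - lambertW 1) • Measure.dirac 0
    + ENNReal.ofReal (lambertW 1) • (expMeasure 1).map Real.toNNReal

/-- The defining tail formula: the complementary c.d.f. of `μ_*`. -/
theorem muStar_Ioi (y : ℝ≥0) :
    muStar (Set.Ioi y) = ENNReal.ofReal (lambertW 1 * Real.exp (-(y : ℝ))) := by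
  have hW := (lambertW_spec (zero_le_one : (0 : ℝ) ≤ 1)).1
  have hpre : Real.toNNReal ⁻¹' (Set.Ioi y) = Set.Ioi (y : ℝ) := by
    ext x
    simp [Real.lt_toNNReal_iff_coe_lt]
  have : IsProbabilityMeasure (expMeasure 1) := isProbabilityMeasure_expMeasure one_pos
  have hexp : expMeasure 1 (Set.Ioi (y : ℝ)) = ENNReal.ofReal (Real.exp (-(y : ℝ))) := by
    have h1 := cdf_expMeasure_eq (r := 1) one_pos (y : ℝ)
    rw [cdf_eq_real, if_pos y.coe_nonneg, one_mul] at h1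
    rw [← Set.compl_Iic, ← ofReal_measureReal, probReal_compl_eq_one_sub measurableSet_Iic, h1]
    congr 1
    ring
  rw [muStar, Measure.add_apply, Measure.smul_apply, Measure.smul_apply,
    Measure.map_apply measurable_real_toNNReal measurableSet_Ioi, hpre, hexp,
    Measure.dirac_apply' _ measurableSet_Ioi, ENNReal.ofReal_mul hW]
  simp

instance : IsProbabilityMeasure muStar := by
  have : IsProbabilityMeasure (expMeasure 1) := isProbabilityMeasure_expMeasure one_pos
  have : IsProbabilityMeasure ((expMeasure 1).map Real.toNNReal) :=
    Measure.isProbabilityMeasure_map measurable_real_toNNReal.aemeasurable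
  refine ⟨?_⟩
  have hW := (lambertW_spec (zero_le_one : (0 : ℝ) ≤ 1)).1
  have hW1 := lambertW_one_le_one
  rw [muStar, Measure.add_apply, Measure.smul_apply, Measure.smul_apply, measure_univ,
    measure_univ, smul_eq_mul, smul_eq_mul, mul_one, mul_one,
    ← ENNReal.ofReal_add (by linarith) hW]
  simp

/-- The law on `ℝ^ℕ` of the increasingly ordered points `ξ₁ < ξ₂ < ⋯` of a Poisson process of
rate `1` on `[0, ∞)`: the partial sums of i.i.d. standard exponential gaps.  The point `ξ_{j+1}`
is the coordinate with index `j`. -/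
def poissonPointsLaw : Measure (ℕ → ℝ) :=
  (Measure.infinitePi (fun _ : ℕ => expMeasure 1)).map
    (fun gap n => ∑ i ∈ Finset.range (n + 1), gap i)

/-- The map of the edge-cover recursion, `g(ξ; x) = min_j (ξ_j - x_j)⁺`. -/
def edgeCoverMap (pts : ℕ → ℝ) (x : ℕ → ℝ≥0) : ℝ≥0 :=
  ⨅ j : ℕ, Real.toNNReal (pts j - x j)

/-- Vertices of the infinite tree: finite words over a countably infinite alphabet.  The root is
the empty word, and the children of `v` are the words `v ++ [j]`. -/
abbrev Vertex : Type := List ℕ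

/-- `X` is an invariant recursive tree process with marginal `μ`, innovations `ξ` of law `ν`, and
recursion map `g` (in the case where every vertex has infinitely many children): the innovations
are i.i.d., the recursion holds almost surely at each vertex, and for each `d` the variables at
depth `d` are i.i.d. with law `μ` and are independent of the innovations at depths less
than `d`. -/
structure IsInvariantRTP {Ω E S : Type*} [MeasurableSpace Ω] [MeasurableSpace E]
    [MeasurableSpace S] (P : Measure Ω) (ν : Measure E) (g : E → (ℕ → S) → S) (μ : Measure S)
    (ξ : Vertex → Ω → E) (X : Vertex → Ω → S) : Prop where
  measurable_innovation : ∀ v, Measurable (ξ v)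
  measurable_value : ∀ v, Measurable (X v)
  law_innovation : ∀ v, P.map (ξ v) = ν
  iIndep_innovation : iIndepFun ξ P
  recursion : ∀ v, ∀ᵐ ω ∂P, X v ω = g (ξ v ω) (fun j => X (v ++ [j]) ω)
  law_value : ∀ v, P.map (X v) = μ
  iIndep_level : ∀ d : ℕ, iIndepFun (fun v : {v : Vertex // v.length = d} => X v) P
  indep_level_innovation : ∀ d : ℕ,
    IndepFun (fun ω (v : {v : Vertex // v.length = d}) => X v ω)
      (fun ω (u : {u : Vertex // u.length < d}) => ξ u ω) P

/-- Endogeny: the root variable is almost surely equal to a random variable measurable with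
respect to the `σ`-algebra generated by all the innovations. -/
def IsEndogenous {Ω E S : Type*} [MeasurableSpace Ω] [MeasurableSpace E] [MeasurableSpace S]
    (P : Measure Ω) (ξ : Vertex → Ω → E) (X : Vertex → Ω → S) : Prop :=
  ∃ Y : Ω → S,
    Measurable[⨆ v : Vertex, MeasurableSpace.comap (ξ v) inferInstance] Y ∧ X [] =ᵐ[P] Y

end

end EdgeCover

/-!
The edge-cover map `x ↦ min_j (ξ_j - x_j)⁺` is antitone in `x`. Running the recursion from depth
`n` of the tree with value `0` at that depth gives iterates `A_n` at each vertex, measurable with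
respect to the innovations, such that every solution `X` of the recursion satisfies `A_{2k} ≤ X`
(`treeIter_even_le`). The even iterates increase to a limit `A` (`treeLimit`), so that `A ≤ X`;
moreover `A ≤ A_{2k+1}` for every `k`.

The laws are explicit. Let `μ_c = (1 - c) δ₀ + c Exp(1)` (`expMixture`), so that `μ_*` is `μ_c` for
`c = W(1)`. If the marks `x_j` are independent with law `μ_c` and independent of the Poisson points
`ξ_j`, then the minimum is at least `y > 0` if and only if `ξ_j - x_j ≥ y` for every `j`, which has
probability `exp (-(c + y))`, `c` being the mean of `μ_c`; hence the edge-cover map sends `μ_c` to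
`μ_{exp (-c)}` (`map_edgeCoverMap`). Therefore `A_n` has law `μ_{c_n}` with `c_0 = 0` and
`c_{n+1} = exp (-c_n)`, and `c_n` tends to the fixed point `W(1)` of `c ↦ exp (-c)`, so that `A`
has law `μ_*` (`map_treeLimit`). Two variables that are ordered and have the same law are almost
surely equal (`ae_eq_of_ae_le_of_map_eq`): this gives `X = A`, which is endogeny. For existence,
`A` itself is a solution: as `A ≤ A_{2k+1}`, `A` is at most the edge-cover map applied to the
values of `A` at the children, which again has law `μ_*`, so the two agree almost surely.

The avoidance probability is computed on partial sums of exponential gaps. Conditioning on the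
first gap gives a linear integral equation, for which the explicit candidate `avoidProb` is a fixed
point (`lintegral_mul_avoidProb`); the probabilities for the first `n` points are the iterates of
the same operator from `1`, and their distance to the fixed point is at most `exp (-r) / 2 ^ n`
at the starting point `r` (`finiteAvoidProb_le`).
-/

open Filter Set Topology

namespace EdgeCover

/-! ### Independence of disjoint blocks -/

theorem iIndep_biSup_of_pairwise_disjoint {Ω ι κ : Type*} {mΩ : MeasurableSpace Ω}
    {P : Measure Ω} {m : ι → MeasurableSpace Ω} (hle : ∀ i, m i ≤ mΩ) (h : iIndep m P)
    {S : κ → Set ι} (hS : Pairwise (Function.onFun Disjoint S)) :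
    iIndep (fun k => ⨆ i ∈ S k, m i) P := by
  classical
  have := h.isProbabilityMeasure
  rw [iIndep_iff]
  intro s f
  induction s using Finset.induction_on with
  | empty => simp
  | insert a s ha ih =>
    intro hf
    have hd : Disjoint (S a) (⋃ k ∈ s, S k) := by
      rw [Set.disjoint_iUnion₂_right]
      intro k hk
      exact hS (fun e => ha (e ▸ hk))
    have hind := indep_iSup_of_disjoint hle h hd
    rw [Finset.set_biInter_insert, Finset.prod_insert ha,
      ← ih (fun i hi => hf i (Finset.mem_insert_of_mem hi))]
    refine (Indep_iff _ _ _).1 hind _ _ (hf a (Finset.mem_insert_self a s)) ?_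
    refine Finset.measurableSet_biInter _ (fun k hk => ?_)
    have hle' : (⨆ i ∈ S k, m i) ≤ ⨆ i ∈ ⋃ k ∈ s, S k, m i :=
      biSup_mono (fun i hi => Set.mem_biUnion hk hi)
    exact hle' _ (hf k (Finset.mem_insert_of_mem hk))

theorem measurable_biSup_comap {Ω ι E : Type*} [MeasurableSpace E] (ξ : ι → Ω → E) {S : Set ι}
    {i : ι} (hi : i ∈ S) :
    Measurable[⨆ i ∈ S, MeasurableSpace.comap (ξ i) inferInstance] (ξ i) :=
  measurable_iff_comap_le.2 (le_biSup (fun i => MeasurableSpace.comap (ξ i) inferInstance) hi)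

/-- The first coordinate of an i.i.d. sequence is independent of the shifted sequence, which has
the law of the whole sequence. -/
theorem infinitePi_map_head_tail {E : Type*} [MeasurableSpace E] (ν : Measure E)
    [IsProbabilityMeasure ν] :
    (Measure.infinitePi (fun _ : ℕ => ν)).map (fun g => (g 0, fun n => g (n + 1)))
      = ν.prod (Measure.infinitePi (fun _ : ℕ => ν)) := by
  set Q := Measure.infinitePi (fun _ : ℕ => ν)
  have hi : iIndepFun (fun (n : ℕ) (g : ℕ → E) => g n) Q :=
    iIndepFun_infinitePi (P := fun _ : ℕ => ν) (X := fun _ x => x) (fun _ => measurable_id)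
  have hev : ∀ n : ℕ, Q.map (fun g => g n) = ν := fun n => Measure.infinitePi_map_eval _ n
  have htail : Q.map (fun g n => g (n + 1)) = Q := by
    have h := (hi.precomp (g := fun n : ℕ => n + 1)
      (fun a b hab => by simpa using hab)).map_fun_eq_infinitePi_map
        (fun n => measurable_pi_apply _)
    simp only [hev] at h
    exact h
  have hind : IndepFun (fun g : ℕ → E => g 0) (fun g n => g (n + 1)) Q := by
    have hd : Disjoint ({0} : Set ℕ) {n | n ≠ 0} := by simp
    refine indep_of_indep_of_le_left (indep_of_indep_of_le_right
      (indep_iSup_of_disjoint (fun n => (measurable_pi_apply n).comap_le) hi.iIndep hd) ?_) ?_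
    · rw [← measurable_iff_comap_le]
      exact @measurable_pi_lambda _ _ _ (_) _ _ fun n =>
        measurable_biSup_comap (fun (n : ℕ) (g : ℕ → E) => g n) (S := {n | n ≠ 0}) (by simp)
    · rw [← measurable_iff_comap_le]
      exact measurable_biSup_comap (fun (n : ℕ) (g : ℕ → E) => g n) (S := {0}) (by simp)
  have h := (indepFun_iff_map_prod_eq_prod_map_map (by fun_prop : Measurable _).aemeasurable
    (by fun_prop : Measurable _).aemeasurable).1 hind
  rw [h, hev, htail]

/-! ### Exponential laws with an atom at the origin -/

/-- The mixture `(1 - c) δ₀ + c Exp(1)` on `[0, ∞)`. -/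
noncomputable def expMixture (c : ℝ) : Measure ℝ≥0 :=
  ENNReal.ofReal (1 - c) • Measure.dirac 0
    + ENNReal.ofReal c • (expMeasure 1).map Real.toNNReal

theorem muStar_eq_expMixture : muStar = expMixture (lambertW 1) := rfl

theorem expMixture_zero : expMixture 0 = Measure.dirac 0 := by simp [expMixture]

theorem isProbabilityMeasure_expMixture {c : ℝ} (h0 : 0 ≤ c) (h1 : c ≤ 1) :
    IsProbabilityMeasure (expMixture c) := by
  have : IsProbabilityMeasure (expMeasure 1) := isProbabilityMeasure_expMeasure one_pos
  have : IsProbabilityMeasure ((expMeasure 1).map Real.toNNReal) :=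
    Measure.isProbabilityMeasure_map measurable_real_toNNReal.aemeasurable
  refine ⟨?_⟩
  rw [expMixture, Measure.add_apply, Measure.smul_apply, Measure.smul_apply, measure_univ,
    measure_univ, smul_eq_mul, smul_eq_mul, mul_one, mul_one,
    ← ENNReal.ofReal_add (by linarith) h0]
  simp

theorem expMeasure_one_Iic {y : ℝ} (hy : 0 ≤ y) :
    expMeasure 1 (Iic y) = ENNReal.ofReal (1 - Real.exp (-y)) := by
  have : IsProbabilityMeasure (expMeasure 1) := isProbabilityMeasure_expMeasure one_pos
  have h1 := cdf_expMeasure_eq (r := 1) one_pos y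
  rw [cdf_eq_real, if_pos hy, one_mul] at h1
  rw [← ofReal_measureReal, h1]

theorem expMixture_Iic {c : ℝ} (h0 : 0 ≤ c) (h1 : c ≤ 1) (y : ℝ≥0) :
    expMixture c (Iic y) = ENNReal.ofReal (1 - c * Real.exp (-(y : ℝ))) := by
  have hpre : Real.toNNReal ⁻¹' (Iic y) = Iic (y : ℝ) := by
    ext x
    simp [Real.toNNReal_le_iff_le_coe]
  have he : Real.exp (-(y : ℝ)) ≤ 1 := by simp
  rw [expMixture, Measure.add_apply, Measure.smul_apply, Measure.smul_apply,
    Measure.map_apply measurable_real_toNNReal measurableSet_Iic, hpre,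
    expMeasure_one_Iic y.coe_nonneg, Measure.dirac_apply' _ measurableSet_Iic, smul_eq_mul,
    smul_eq_mul, ← ENNReal.ofReal_mul h0]
  rw [Set.indicator_of_mem (by simp), Pi.one_apply, mul_one,
    ← ENNReal.ofReal_add (by linarith) (by apply mul_nonneg h0; linarith)]
  congr 1
  ring

theorem expMixture_Ici {c : ℝ} (h0 : 0 ≤ c) {y : ℝ≥0} (hy : 0 < y) :
    expMixture c (Ici y) = ENNReal.ofReal (c * Real.exp (-(y : ℝ))) := by
  have hpre : Real.toNNReal ⁻¹' (Ici y) = Ici (y : ℝ) := by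
    ext x
    simp [Real.le_toNNReal_iff_coe_le' hy]
  have : IsProbabilityMeasure (expMeasure 1) := isProbabilityMeasure_expMeasure one_pos
  have hac : expMeasure 1 ≪ volume := withDensity_absolutelyContinuous _ _
  have hexp : expMeasure 1 (Ici (y : ℝ)) = ENNReal.ofReal (Real.exp (-(y : ℝ))) := by
    rw [← measure_congr (hac.ae_eq Ioi_ae_eq_Ici)]
    have h1 := cdf_expMeasure_eq (r := 1) one_pos (y : ℝ)
    rw [cdf_eq_real, if_pos y.coe_nonneg, one_mul] at h1
    rw [← Set.compl_Iic, ← ofReal_measureReal, probReal_compl_eq_one_sub measurableSet_Iic, h1]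
    congr 1
    ring
  rw [expMixture, Measure.add_apply, Measure.smul_apply, Measure.smul_apply,
    Measure.map_apply measurable_real_toNNReal measurableSet_Ici, hpre, hexp,
    Measure.dirac_apply' _ measurableSet_Ici, ENNReal.ofReal_mul h0]
  simp [hy.ne']

/-- The distribution function of `expMixture c`, at a real argument. -/
theorem expMixture_coe_le {c : ℝ} (h0 : 0 ≤ c) (h1 : c ≤ 1) (r : ℝ) :
    expMixture c {x | (x : ℝ) ≤ r}
      = (Ici 0).indicator (fun t => ENNReal.ofReal (1 - c * Real.exp (-t))) r := by
  by_cases hr : 0 ≤ r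
  · rw [Set.indicator_of_mem (by simpa using hr)]
    lift r to ℝ≥0 using hr
    exact expMixture_Iic h0 h1 r
  · rw [Set.indicator_of_notMem (by simpa using hr)]
    convert measure_empty (μ := expMixture c)
    ext x
    have := x.coe_nonneg
    simp only [mem_ofPred_eq, mem_empty_iff_false, iff_false]
    linarith

/-! ### The avoidance probability of the marked Poisson process -/

theorem lintegral_expMeasure_one {f : ℝ → ℝ≥0∞} (hf : Measurable f) :
    ∫⁻ u, f u ∂(expMeasure 1) = ∫⁻ u in Ioi 0, ENNReal.ofReal (Real.exp (-u)) * f u := by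
  have hm : Measurable (exponentialPDF 1) :=
    (measurable_exponentialPDFReal 1).ennreal_ofReal
  have h1 : ∫⁻ u, f u ∂(expMeasure 1) = ∫⁻ u, exponentialPDF 1 u * f u :=
    lintegral_withDensity_eq_lintegral_mul _ hm hf
  rw [h1, ← setLIntegral_congr Ioi_ae_eq_Ici.symm, ← lintegral_indicator measurableSet_Ici]
  refine lintegral_congr fun u => ?_
  by_cases hu : 0 ≤ u
  · rw [Set.indicator_of_mem (by simpa using hu), exponentialPDF_of_nonneg hu]
    simp
  · rw [Set.indicator_of_notMem (by simpa using hu), exponentialPDF_of_neg (by linarith),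
      zero_mul]

/-- The probability that no point of a rate one Poisson process on `[r, ∞)`, each point being
lowered by an independent mark of law `expMixture c`, becomes negative.  It is
`exp (-∫ₜ (1 - F t) dt)`, the integral being over `t ≥ r` and `F` the distribution function of
`expMixture c`. -/
noncomputable def avoidProb (c r : ℝ) : ℝ :=
  Real.exp (-max 0 (-r)) * Real.exp (-(c * Real.exp (-(r + max 0 (-r)))))

theorem avoidProb_nonneg (c r : ℝ) : 0 ≤ avoidProb c r := by unfold avoidProb; positivity

theorem avoidProb_of_nonneg (c : ℝ) {r : ℝ} (hr : 0 ≤ r) :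
    avoidProb c r = Real.exp (-(c * Real.exp (-r))) := by
  simp [avoidProb, max_eq_left (neg_nonpos.2 hr)]

theorem avoidProb_neg (c : ℝ) {y : ℝ} (hy : 0 ≤ y) :
    avoidProb c (-y) = Real.exp (-c) * Real.exp (-y) := by
  simp [avoidProb, max_eq_right hy, mul_comm]

theorem avoidProb_le_one {c : ℝ} (h0 : 0 ≤ c) (r : ℝ) : avoidProb c r ≤ 1 := by
  refine mul_le_one₀ ?_ (by positivity) ?_
  · simp
  · simp only [Real.exp_le_one_iff, Left.neg_nonpos_iff]; positivity

theorem one_le_avoidProb_add_exp {c : ℝ} (h1 : c ≤ 1) (r : ℝ) :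
    1 ≤ avoidProb c r + Real.exp (-r) := by
  rcases le_total 0 r with hr | hr
  · rw [avoidProb_of_nonneg c hr]
    have h2 := Real.add_one_le_exp (-(c * Real.exp (-r)))
    nlinarith [Real.exp_pos (-r)]
  · have := avoidProb_nonneg c r
    have : 1 ≤ Real.exp (-r) := by simpa using hr
    linarith

@[fun_prop]
theorem measurable_avoidProb (c : ℝ) : Measurable (avoidProb c) := by
  unfold avoidProb; fun_prop

theorem measurable_expMixture_coe_le {c : ℝ} (h0 : 0 ≤ c) (h1 : c ≤ 1) :
    Measurable (fun r : ℝ => expMixture c {x | (x : ℝ) ≤ r}) := by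
  simp_rw [expMixture_coe_le h0 h1]
  exact Measurable.indicator (by fun_prop) measurableSet_Ici

/-- Conditioning on the first point of the Poisson process: `avoidProb c` is a fixed point of the
resulting integral operator. -/
theorem lintegral_mul_avoidProb {c : ℝ} (h0 : 0 ≤ c) (h1 : c ≤ 1) (r : ℝ) :
    ∫⁻ u, expMixture c {x | (x : ℝ) ≤ r + u} * ENNReal.ofReal (avoidProb c (r + u))
        ∂(expMeasure 1) = ENNReal.ofReal (avoidProb c r) := by
  have hm := measurable_expMixture_coe_le h0 h1
  have hg : Measurable fun u : ℝ =>
      expMixture c {x | (x : ℝ) ≤ r + u} * ENNReal.ofReal (avoidProb c (r + u)) :=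
    (hm.comp (measurable_const_add r)).mul (by fun_prop)
  rw [lintegral_expMeasure_one hg]
  set a := max 0 (-r) with ha
  have ha0 : 0 ≤ a := le_max_left _ _
  have har : -r ≤ a := le_max_right _ _
  -- Up to a null set, the integrand lives on `Ioi a`, where it is the derivative of
  -- `u ↦ -exp (-u) * exp (-c * exp (-(r + u)))`.
  let F : ℝ → ℝ := fun u => -(Real.exp (-u) * Real.exp (-(c * Real.exp (-(r + u)))))
  let F' : ℝ → ℝ := fun u =>
    Real.exp (-u) * ((1 - c * Real.exp (-(r + u))) * Real.exp (-(c * Real.exp (-(r + u)))))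
  have hle : ∀ u, a < u → c * Real.exp (-(r + u)) ≤ 1 := fun u hu =>
    mul_le_one₀ h1 (by positivity) (by simp; linarith)
  have hF : ∀ u, HasDerivAt F (F' u) u := by
    intro u
    have h := (((hasDerivAt_id u).neg.exp).mul
      (((((hasDerivAt_id u).const_add r).neg.exp).const_mul c).neg.exp)).neg
    refine h.congr_deriv ?_
    simp only [F', id, Pi.neg_apply]
    ring
  have hpos : ∀ u ∈ Ioi a, 0 ≤ F' u := fun u hu => by
    have := hle u hu
    have : 0 ≤ 1 - c * Real.exp (-(r + u)) := by linarith
    positivity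
  have hlim : Tendsto F atTop (𝓝 0) := by
    refine squeeze_zero_norm (a := fun u => Real.exp (-u)) (fun u => ?_)
      (Real.tendsto_exp_neg_atTop_nhds_zero)
    rw [Real.norm_eq_abs, abs_neg, abs_of_nonneg (by positivity)]
    refine mul_le_of_le_one_right (by positivity) ?_
    simp only [Real.exp_le_one_iff, Left.neg_nonpos_iff]; positivity
  have hint := integrableOn_Ioi_deriv_of_nonneg' (fun u _ => hF u) hpos hlim
  have hval := integral_Ioi_of_hasDerivAt_of_nonneg' (fun u _ => hF u) hpos hlim
  have hrhs : avoidProb c r = ∫ u in Ioi a, F' u := by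
    rw [hval]; simp [F, avoidProb, ha]
  rw [hrhs, ofReal_integral_eq_lintegral_ofReal hint
    ((ae_restrict_iff' measurableSet_Ioi).2 (Eventually.of_forall hpos)),
    ← lintegral_indicator measurableSet_Ioi, ← lintegral_indicator measurableSet_Ioi]
  refine lintegral_congr_ae ?_
  have hne : ∀ᵐ u : ℝ, u ≠ a := by simp [ae_iff]
  filter_upwards [hne] with u hu
  by_cases hau : a < u
  · have hu0 : 0 < u := ha0.trans_lt hau
    have hru : 0 ≤ r + u := by linarith
    have := hle u hau
    rw [indicator_of_mem (by simpa using hu0), indicator_of_mem (by simpa using hau),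
      expMixture_coe_le h0 h1, indicator_of_mem (by simpa using hru),
      avoidProb_of_nonneg c hru, ← ENNReal.ofReal_mul (by linarith),
      ← ENNReal.ofReal_mul (by positivity)]
  · rw [indicator_of_notMem (s := Ioi a) (by simpa using hau)]
    have hlt : u < a := lt_of_le_of_ne (not_lt.1 hau) hu
    rcases lt_max_iff.1 (ha ▸ hlt) with h | h
    · rw [indicator_of_notMem (by simp; linarith)]
    · have hzero : expMixture c {x | (x : ℝ) ≤ r + u} = 0 := by
        rw [expMixture_coe_le h0 h1, indicator_of_notMem (by simp; linarith)]
      simp [indicator, hzero]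

theorem lintegral_exp_neg_add (r : ℝ) :
    ∫⁻ u, ENNReal.ofReal (Real.exp (-(r + u))) ∂(expMeasure 1)
      = ENNReal.ofReal (Real.exp (-r) / 2) := by
  rw [lintegral_expMeasure_one (by fun_prop)]
  let F : ℝ → ℝ := fun u => -(Real.exp (-r) / 2 * Real.exp (-(2 * u)))
  let F' : ℝ → ℝ := fun u => Real.exp (-u) * Real.exp (-(r + u))
  have hF : ∀ u, HasDerivAt F (F' u) u := by
    intro u
    have h := ((((hasDerivAt_id u).const_mul 2).neg.exp).const_mul (Real.exp (-r) / 2)).neg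
    refine h.congr_deriv ?_
    simp only [F', id, Pi.neg_apply, neg_add, Real.exp_add, two_mul]
    ring
  have hpos : ∀ u ∈ Ioi (0 : ℝ), 0 ≤ F' u := fun u _ => by positivity
  have hlim : Tendsto F atTop (𝓝 0) := by
    have h : Tendsto (fun u : ℝ => Real.exp (-(2 * u))) atTop (𝓝 0) :=
      Real.tendsto_exp_neg_atTop_nhds_zero.comp (tendsto_id.const_mul_atTop two_pos)
    simpa [F] using (h.const_mul (Real.exp (-r) / 2)).neg
  have hint := integrableOn_Ioi_deriv_of_nonneg' (fun u _ => hF u) hpos hlim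
  have hval := integral_Ioi_of_hasDerivAt_of_nonneg' (fun u _ => hF u) hpos hlim
  have hrhs : Real.exp (-r) / 2 = ∫ u in Ioi 0, F' u := by
    rw [hval]; simp [F]
  rw [hrhs, ofReal_integral_eq_lintegral_ofReal hint
    ((ae_restrict_iff' measurableSet_Ioi).2 (Eventually.of_forall hpos))]
  refine lintegral_congr fun u => ?_
  rw [← ENNReal.ofReal_mul (by positivity)]

/-- The probability that the first `n` points of a rate one Poisson process on `[r, ∞)`, lowered
by independent marks of law `expMixture c`, are all nonnegative. -/
noncomputable def finiteAvoidProb (c : ℝ) (n : ℕ) (r : ℝ) : ℝ≥0∞ :=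
  ∫⁻ gap, ∏ j ∈ Finset.range n,
      expMixture c {x | (x : ℝ) ≤ r + ∑ i ∈ Finset.range (j + 1), gap i}
    ∂(Measure.infinitePi (fun _ : ℕ => expMeasure 1))

theorem finiteAvoidProb_succ {c : ℝ} (h0 : 0 ≤ c) (h1 : c ≤ 1) (n : ℕ) (r : ℝ) :
    finiteAvoidProb c (n + 1) r
      = ∫⁻ u, expMixture c {x | (x : ℝ) ≤ r + u} * finiteAvoidProb c n (r + u)
          ∂(expMeasure 1) := by
  have : IsProbabilityMeasure (expMeasure 1) := isProbabilityMeasure_expMeasure one_pos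
  have hm := measurable_expMixture_coe_le h0 h1
  let f : ℝ × (ℕ → ℝ) → ℝ≥0∞ := fun p =>
    expMixture c {x | (x : ℝ) ≤ r + p.1} * ∏ j ∈ Finset.range n,
      expMixture c {x | (x : ℝ) ≤ (r + p.1) + ∑ i ∈ Finset.range (j + 1), p.2 i}
  have hf : Measurable f := by
    refine (hm.comp (by fun_prop)).mul (Finset.measurable_prod _ fun j _ => ?_)
    exact hm.comp (g := fun r : ℝ => expMixture c {x | (x : ℝ) ≤ r}) (by fun_prop)
  have h : finiteAvoidProb c (n + 1) r
      = ∫⁻ p, f p ∂((expMeasure 1).prod (Measure.infinitePi (fun _ : ℕ => expMeasure 1))) := by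
    rw [← infinitePi_map_head_tail, lintegral_map hf (by fun_prop)]
    refine lintegral_congr fun g => ?_
    simp only [f]
    rw [Finset.prod_range_succ', mul_comm]
    congr 1
    · simp
    · refine Finset.prod_congr rfl fun j _ => ?_
      rw [Finset.sum_range_succ' _ (j + 1), add_assoc, add_comm (g 0)]
  rw [h, lintegral_prod _ hf.aemeasurable]
  refine lintegral_congr fun u => ?_
  simp only [f]
  rw [lintegral_const_mul]
  · rfl
  · exact Finset.measurable_prod _ fun j _ =>
      hm.comp (g := fun r : ℝ => expMixture c {x | (x : ℝ) ≤ r}) (by fun_prop)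

theorem avoidProb_le_finiteAvoidProb {c : ℝ} (h0 : 0 ≤ c) (h1 : c ≤ 1) (n : ℕ) (r : ℝ) :
    ENNReal.ofReal (avoidProb c r) ≤ finiteAvoidProb c n r := by
  have : IsProbabilityMeasure (expMeasure 1) := isProbabilityMeasure_expMeasure one_pos
  induction n generalizing r with
  | zero => simpa [finiteAvoidProb] using avoidProb_le_one h0 r
  | succ n ih =>
    rw [finiteAvoidProb_succ h0 h1, ← lintegral_mul_avoidProb h0 h1]
    exact lintegral_mono fun u => mul_le_mul_right (ih _) _

/-- The error is at most the mean of `exp (-T)` for the `n`-th point `T`. -/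
theorem finiteAvoidProb_le {c : ℝ} (h0 : 0 ≤ c) (h1 : c ≤ 1) (n : ℕ) (r : ℝ) :
    finiteAvoidProb c n r
      ≤ ENNReal.ofReal (avoidProb c r) + ENNReal.ofReal (Real.exp (-r) / 2 ^ n) := by
  have : IsProbabilityMeasure (expMeasure 1) := isProbabilityMeasure_expMeasure one_pos
  have := isProbabilityMeasure_expMixture h0 h1
  have hm := measurable_expMixture_coe_le h0 h1
  induction n generalizing r with
  | zero =>
    rw [← ENNReal.ofReal_add (avoidProb_nonneg c r) (by positivity)]
    simpa [finiteAvoidProb] using one_le_avoidProb_add_exp h1 r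
  | succ n ih =>
    rw [finiteAvoidProb_succ h0 h1]
    calc _ ≤ ∫⁻ u, (expMixture c {x | (x : ℝ) ≤ r + u} * ENNReal.ofReal (avoidProb c (r + u))
            + ENNReal.ofReal (1 / 2 ^ n) * ENNReal.ofReal (Real.exp (-(r + u))))
              ∂(expMeasure 1) := by
          refine lintegral_mono fun u => ?_
          refine (mul_le_mul_right (ih (r + u)) _).trans ?_
          rw [mul_add, ← ENNReal.ofReal_mul (by positivity), one_div_mul_eq_div]
          gcongr
          exact mul_le_of_le_one_left (by positivity) prob_le_one
      _ = _ := by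
          rw [lintegral_add_right _ (by fun_prop), lintegral_mul_avoidProb h0 h1,
            lintegral_const_mul _ (by fun_prop), lintegral_exp_neg_add,
            ← ENNReal.ofReal_mul (by positivity)]
          congr 2
          rw [pow_succ]
          field_simp

theorem tendsto_finiteAvoidProb {c : ℝ} (h0 : 0 ≤ c) (h1 : c ≤ 1) (r : ℝ) :
    Tendsto (fun n => finiteAvoidProb c n r) atTop (𝓝 (ENNReal.ofReal (avoidProb c r))) := by
  refine tendsto_of_tendsto_of_tendsto_of_le_of_le tendsto_const_nhds ?_
    (fun n => avoidProb_le_finiteAvoidProb h0 h1 n r) (fun n => finiteAvoidProb_le h0 h1 n r)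
  have h : Tendsto (fun n : ℕ => Real.exp (-r) / 2 ^ n) atTop (𝓝 0) :=
    tendsto_const_nhds.div_atTop (tendsto_pow_atTop_atTop_of_one_lt one_lt_two)
  simpa using tendsto_const_nhds.add (ENNReal.tendsto_ofReal h)

/-! ### The action of the edge-cover map on exponential mixtures -/

instance isProbabilityMeasure_poissonPointsLaw : IsProbabilityMeasure poissonPointsLaw := by
  have : IsProbabilityMeasure (expMeasure 1) := isProbabilityMeasure_expMeasure one_pos
  exact Measure.isProbabilityMeasure_map
    (by fun_prop : Measurable fun (gap : ℕ → ℝ) n =>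
      ∑ i ∈ Finset.range (n + 1), gap i).aemeasurable

theorem measurable_edgeCoverMap :
    Measurable (fun p : (ℕ → ℝ) × (ℕ → ℝ≥0) => edgeCoverMap p.1 p.2) := by
  unfold edgeCoverMap
  exact Measurable.iInf fun j => by fun_prop

theorem edgeCoverMap_antitone (pts : ℕ → ℝ) : Antitone (edgeCoverMap pts) := by
  intro x x' h
  refine ciInf_mono (OrderBot.bddBelow _) fun j => Real.toNNReal_mono ?_
  have : (x j : ℝ) ≤ x' j := by exact_mod_cast h j
  linarith

theorem le_edgeCoverMap_iff {pts : ℕ → ℝ} {x : ℕ → ℝ≥0} {y : ℝ≥0} (hy : 0 < y) :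
    y ≤ edgeCoverMap pts x ↔ ∀ j, (x j : ℝ) ≤ -y + pts j := by
  rw [edgeCoverMap, le_ciInf_iff (OrderBot.bddBelow _)]
  refine forall_congr' fun j => ?_
  rw [Real.le_toNNReal_iff_coe_le' hy]
  constructor <;> intro h <;> linarith

/-- The edge-cover map sends `expMixture c` to `expMixture (exp (-c))`: its value is at least `y`
if and only if every lowered point is at least `y`, which has probability
`avoidProb c (-y) = exp (-c) * exp (-y)`. -/
theorem map_edgeCoverMap {c : ℝ} (h0 : 0 ≤ c) (h1 : c ≤ 1) :
    (poissonPointsLaw.prod (Measure.infinitePi (fun _ : ℕ => expMixture c))).map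
        (fun p => edgeCoverMap p.1 p.2) = expMixture (Real.exp (-c)) := by
  have : IsProbabilityMeasure (expMeasure 1) := isProbabilityMeasure_expMeasure one_pos
  have := isProbabilityMeasure_expMixture h0 h1
  have hsum : Measurable (fun (gap : ℕ → ℝ) n => ∑ i ∈ Finset.range (n + 1), gap i) := by
    fun_prop
  have := isProbabilityMeasure_expMixture (Real.exp_pos (-c)).le (by simpa using h0)
  have := Measure.isProbabilityMeasure_map (μ := poissonPointsLaw.prod
    (Measure.infinitePi (fun _ : ℕ => expMixture c))) measurable_edgeCoverMap.aemeasurable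
  have hm := measurable_expMixture_coe_le h0 h1
  refine Measure.ext_of_Ici _ _ fun y => ?_
  rcases eq_or_ne y 0 with rfl | hy
  · simp [show Ici (0 : ℝ≥0) = univ from Set.Ici_bot]
  replace hy : 0 < y := pos_iff_ne_zero.2 hy
  rw [expMixture_Ici (Real.exp_pos _).le hy, Measure.map_apply measurable_edgeCoverMap
    measurableSet_Ici, ← avoidProb_neg c y.coe_nonneg]
  let A : ℕ → Set ((ℕ → ℝ) × (ℕ → ℝ≥0)) := fun n =>
    {p | ∀ j ∈ Finset.range n, (p.2 j : ℝ) ≤ -y + p.1 j}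
  have hA : ∀ n, MeasurableSet (A n) := fun n => by
    have : A n = ⋂ j ∈ Finset.range n, {p | (p.2 j : ℝ) ≤ -y + p.1 j} := by
      ext p; simp [A]
    rw [this]
    exact Finset.measurableSet_biInter _ fun j _ =>
      measurableSet_le (by fun_prop) (by fun_prop)
  have hpre : (fun p : (ℕ → ℝ) × (ℕ → ℝ≥0) => edgeCoverMap p.1 p.2) ⁻¹' Ici y = ⋂ n, A n := by
    ext p
    simp only [mem_preimage, mem_Ici, le_edgeCoverMap_iff hy, mem_iInter, A, mem_ofPred_eq,
      Finset.mem_range]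
    exact ⟨fun h n j _ => h j, fun h j => h (j + 1) j (Nat.lt_succ_self j)⟩
  have hanti : Antitone A := fun a b hab p hp j hj =>
    hp j (Finset.range_mono hab hj)
  rw [hpre]
  refine tendsto_nhds_unique
    (tendsto_measure_iInter_atTop (fun n => (hA n).nullMeasurableSet) hanti
      ⟨0, measure_ne_top _ _⟩) ?_
  convert tendsto_finiteAvoidProb h0 h1 (-(y : ℝ)) using 2 with n
  simp only [Function.comp_apply]
  rw [Measure.prod_apply (hA n), finiteAvoidProb]
  have hbox : ∀ pts : ℕ → ℝ, Measure.infinitePi (fun _ : ℕ => expMixture c)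
      (Prod.mk pts ⁻¹' A n)
        = ∏ j ∈ Finset.range n, expMixture c {x | (x : ℝ) ≤ -y + pts j} := by
    intro pts
    rw [← Measure.infinitePi_pi (fun _ : ℕ => expMixture c) (s := Finset.range n)]
    · rfl
    · intro j _
      exact measurableSet_le (by fun_prop) (by fun_prop)
  simp_rw [hbox]
  rw [poissonPointsLaw, lintegral_map _ hsum]
  exact Finset.measurable_prod _ fun j _ =>
      hm.comp (g := fun r : ℝ => expMixture c {x | (x : ℝ) ≤ r}) (by fun_prop)

/-! ### Ordered random variables with the same law -/

/-- Random variables that are ordered almost surely and have the same law agree almost surely. -/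
theorem ae_eq_of_ae_le_of_map_eq {Ω : Type*} [MeasurableSpace Ω] {P : Measure Ω}
    [IsProbabilityMeasure P] {U V : Ω → ℝ≥0} (hU : Measurable U) (hV : Measurable V)
    (hle : U ≤ᵐ[P] V) (h : P.map U = P.map V) : U =ᵐ[P] V := by
  -- The strictly decreasing bounded function `x ↦ exp (-x)` has the same mean under both laws.
  let f : ℝ≥0 → ℝ≥0∞ := fun x => ENNReal.ofReal (Real.exp (-(x : ℝ)))
  have hf : Measurable f := by fun_prop
  have hf1 : ∀ x, f x ≤ 1 := fun x => by simp [f]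
  have hle' : (fun ω => f (V ω)) ≤ᵐ[P] fun ω => f (U ω) := by
    filter_upwards [hle] with ω hω
    refine ENNReal.ofReal_le_ofReal (Real.exp_le_exp.2 (neg_le_neg ?_))
    exact_mod_cast hω
  have hint : ∫⁻ ω, f (U ω) ∂P = ∫⁻ ω, f (V ω) ∂P := by
    rw [← lintegral_map hf hU, ← lintegral_map hf hV, h]
  have hfin : ∫⁻ ω, f (V ω) ∂P ≠ ∞ :=
    ((lintegral_mono fun ω => hf1 (V ω)).trans_lt (by simp)).ne
  have heq := ae_eq_of_ae_le_of_lintegral_le hle' hfin (hf.comp hU).aemeasurable hint.le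
  filter_upwards [heq] with ω hω
  have := (ENNReal.ofReal_eq_ofReal_iff (Real.exp_pos _).le (Real.exp_pos _).le).1 hω
  have := Real.exp_injective this
  exact_mod_cast (neg_injective this).symm

/-! ### Convergence of the weights -/

/-- The iterates from `0` of `c ↦ exp (-c)`: the weight of the exponential part in the law of the
tree iterates. -/
noncomputable def weight : ℕ → ℝ
  | 0 => 0
  | n + 1 => Real.exp (-weight n)

theorem weight_nonneg (n : ℕ) : 0 ≤ weight n := by
  cases n with
  | zero => exact le_rfl
  | succ n => exact (Real.exp_pos _).le

theorem weight_le_one (n : ℕ) : weight n ≤ 1 := by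
  cases n with
  | zero => exact zero_le_one
  | succ n => simpa [weight] using weight_nonneg n

theorem exp_neg_lambertW_one : Real.exp (-lambertW 1) = lambertW 1 := by
  have h := (lambertW_spec (zero_le_one : (0 : ℝ) ≤ 1)).2
  rw [Real.exp_neg]
  exact (eq_inv_of_mul_eq_one_left h).symm

theorem abs_exp_neg_sub_exp_neg_le {m a b : ℝ} (ha : m ≤ a) (hb : m ≤ b) :
    |Real.exp (-a) - Real.exp (-b)| ≤ Real.exp (-m) * |a - b| := by
  wlog hab : a ≤ b generalizing a b
  · rw [abs_sub_comm, abs_sub_comm a]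
    exact this hb ha (le_of_not_ge hab)
  have h1 : Real.exp (-b) ≤ Real.exp (-a) := Real.exp_le_exp.2 (neg_le_neg hab)
  have h2 : Real.exp (-b) = Real.exp (-a) * Real.exp (-(b - a)) := by
    rw [← Real.exp_add]; congr 1; ring
  have h3 := Real.add_one_le_exp (-(b - a))
  have h4 : Real.exp (-a) ≤ Real.exp (-m) := Real.exp_le_exp.2 (neg_le_neg ha)
  rw [abs_of_nonneg (by linarith), abs_of_nonpos (by linarith), h2]
  calc _ = Real.exp (-a) * (1 - Real.exp (-(b - a))) := by ring
    _ ≤ Real.exp (-a) * (b - a) :=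
      mul_le_mul_of_nonneg_left (by linarith) (Real.exp_pos _).le
    _ ≤ Real.exp (-m) * (b - a) := mul_le_mul_of_nonneg_right h4 (by linarith)
    _ = _ := by ring

/-- After one step the iterates stay above `exp (-1)`, where `c ↦ exp (-c)` is a contraction. -/
theorem tendsto_weight : Tendsto weight atTop (𝓝 (lambertW 1)) := by
  have hw : Real.exp (-1) ≤ lambertW 1 := by
    rw [← exp_neg_lambertW_one]
    exact Real.exp_le_exp.2 (neg_le_neg lambertW_one_le_one)
  have hb : ∀ n, Real.exp (-1) ≤ weight (n + 1) := fun n =>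
    Real.exp_le_exp.2 (neg_le_neg (weight_le_one n))
  set q := Real.exp (-Real.exp (-1)) with hq
  have hq1 : q < 1 := by simpa [hq] using Real.exp_pos (-1)
  have key : ∀ n, |weight (n + 1) - lambertW 1| ≤ q ^ n * |weight 1 - lambertW 1| := by
    intro n
    induction n with
    | zero => simp
    | succ n ih =>
      have h := abs_exp_neg_sub_exp_neg_le (hb n) hw
      rw [exp_neg_lambertW_one] at h
      calc _ ≤ q * |weight (n + 1) - lambertW 1| := h
        _ ≤ q * (q ^ n * |weight 1 - lambertW 1|) := by gcongr
        _ = _ := by ring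
  rw [← tendsto_add_atTop_iff_nat 1, tendsto_iff_norm_sub_tendsto_zero]
  refine squeeze_zero (fun n => norm_nonneg _) key ?_
  simpa using (tendsto_pow_atTop_nhds_zero_of_lt_one (Real.exp_pos _).le hq1).mul_const
    |weight 1 - lambertW 1|

/-! ### Iterates of the recursion on the tree -/

/-- The value at `v` when the recursion is run from depth `n` below `v`, with value `0` at that
depth. -/
noncomputable def treeIter (pts : Vertex → ℕ → ℝ) : ℕ → Vertex → ℝ≥0
  | 0, _ => 0
  | n + 1, v => edgeCoverMap (pts v) (fun j => treeIter pts n (v ++ [j]))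

/-- The limit of the iterates of even order. -/
noncomputable def treeLimit (pts : Vertex → ℕ → ℝ) (v : Vertex) : ℝ≥0 :=
  ⨆ k : ℕ, treeIter pts (2 * k) v

/-- Any solution of the recursion lies above the iterates of even order, as two applications of the
antitone edge-cover map preserve the order. -/
theorem treeIter_even_le {pts : Vertex → ℕ → ℝ} {x : Vertex → ℝ≥0}
    (hx : ∀ v, x v = edgeCoverMap (pts v) (fun j => x (v ++ [j]))) (k : ℕ) (v : Vertex) :
    treeIter pts (2 * k) v ≤ x v := by
  induction k generalizing v with
  | zero => exact zero_le
  | succ k ih =>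
    rw [hx v]
    refine edgeCoverMap_antitone _ fun j => ?_
    rw [hx (v ++ [j])]
    exact edgeCoverMap_antitone _ fun i => ih _

theorem treeIter_even_le_add (pts : Vertex → ℕ → ℝ) (k n : ℕ) (v : Vertex) :
    treeIter pts (2 * k) v ≤ treeIter pts (2 * k + n) v ∧
      treeIter pts (2 * k + 1 + n) v ≤ treeIter pts (2 * k + 1) v := by
  have heven : ∀ k v, treeIter pts (2 * k) v ≤ treeIter pts (2 * k + n) v := by
    intro k
    induction k with
    | zero => exact fun v => zero_le
    | succ k ih =>
      intro v
      rw [show 2 * (k + 1) + n = 2 * k + n + 1 + 1 by ring]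
      exact edgeCoverMap_antitone _ fun i => edgeCoverMap_antitone _ fun j => ih _
  refine ⟨heven k v, ?_⟩
  rw [show 2 * k + 1 + n = 2 * k + n + 1 by ring]
  exact edgeCoverMap_antitone _ fun j => heven k _

theorem treeIter_even_mono (pts : Vertex → ℕ → ℝ) (v : Vertex) :
    Monotone fun k => treeIter pts (2 * k) v :=
  monotone_nat_of_le_succ fun k => (treeIter_even_le_add pts k 2 v).1

theorem treeIter_even_le_odd (pts : Vertex → ℕ → ℝ) (k l : ℕ) (v : Vertex) :
    treeIter pts (2 * k) v ≤ treeIter pts (2 * l + 1) v := by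
  refine (treeIter_even_le_add pts k (2 * l + 1) v).1.trans ?_
  rw [show 2 * k + (2 * l + 1) = 2 * l + 1 + 2 * k by ring]
  exact (treeIter_even_le_add pts l (2 * k) v).2

theorem bddAbove_treeIter_even (pts : Vertex → ℕ → ℝ) (v : Vertex) :
    BddAbove (range fun k => treeIter pts (2 * k) v) :=
  ⟨treeIter pts 1 v, by rintro _ ⟨k, rfl⟩; exact treeIter_even_le_odd pts k 0 v⟩

theorem treeLimit_le_treeIter_odd (pts : Vertex → ℕ → ℝ) (k : ℕ) (v : Vertex) :
    treeLimit pts v ≤ treeIter pts (2 * k + 1) v :=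
  ciSup_le' fun l => treeIter_even_le_odd pts l k v

theorem treeLimit_le_edgeCoverMap (pts : Vertex → ℕ → ℝ) (v : Vertex) :
    treeLimit pts v ≤ edgeCoverMap (pts v) (fun j => treeLimit pts (v ++ [j])) := by
  refine ciSup_le' fun k => ?_
  cases k with
  | zero => exact zero_le
  | succ k =>
    exact edgeCoverMap_antitone _ fun j => treeLimit_le_treeIter_odd pts k _

/-! ### Independence and laws along the tree -/

/-- The `σ`-algebra generated by the innovations in the subtree rooted at `v`. -/
abbrev subtreeSigma {Ω E : Type*} [MeasurableSpace E] (ξ : Vertex → Ω → E) (v : Vertex) :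
    MeasurableSpace Ω :=
  ⨆ u ∈ {u : Vertex | v <+: u}, MeasurableSpace.comap (ξ u) inferInstance

section Independence

variable {Ω E S : Type*} [MeasurableSpace Ω] [MeasurableSpace E] [MeasurableSpace S]
  {P : Measure Ω} {ξ : Vertex → Ω → E} {Y : Vertex → Ω → S}

theorem iIndepFun_level (hξ : ∀ v, Measurable (ξ v)) (hi : iIndepFun ξ P)
    (hY : ∀ v, Measurable[subtreeSigma ξ v] (Y v)) (d : ℕ) :
    iIndepFun (fun v : {v : Vertex // v.length = d} => Y v) P := by
  have hS : Pairwise (Function.onFun Disjoint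
      fun v : {v : Vertex // v.length = d} => {u : Vertex | (v : Vertex) <+: u}) := by
    intro v w hvw
    refine Set.disjoint_left.2 fun u hu hu' => hvw (Subtype.ext ?_)
    exact (List.prefix_of_prefix_length_le hu hu' (v.2.trans w.2.symm).le).eq_of_length
      (v.2.trans w.2.symm)
  have h := iIndep_biSup_of_pairwise_disjoint (fun v => (hξ v).comap_le) hi.iIndep hS
  rw [iIndepFun_iff_iIndep]
  exact iIndep_of_iIndep_of_le h fun v => (hY v).comap_le

theorem indepFun_level_innovation (hξ : ∀ v, Measurable (ξ v)) (hi : iIndepFun ξ P)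
    (hY : ∀ v, Measurable[subtreeSigma ξ v] (Y v)) (d : ℕ) :
    IndepFun (fun ω (v : {v : Vertex // v.length = d}) => Y v ω)
      (fun ω (u : {u : Vertex // u.length < d}) => ξ u ω) P := by
  have hd : Disjoint {u : Vertex | d ≤ u.length} {u : Vertex | u.length < d} :=
    Set.disjoint_left.2 fun u (hu : d ≤ u.length) (hu' : u.length < d) =>
      absurd hu' (not_lt.2 hu)
  refine indep_of_indep_of_le_left (indep_of_indep_of_le_right
    (indep_iSup_of_disjoint (fun v => (hξ v).comap_le) hi.iIndep hd) ?_) ?_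
  · rw [← measurable_iff_comap_le]
    exact @measurable_pi_lambda _ _ _ (_) _ _ fun u => measurable_biSup_comap ξ u.2
  · rw [← measurable_iff_comap_le]
    refine @measurable_pi_lambda _ _ _ (_) _ _ fun v => (hY v).mono ?_ le_rfl
    refine biSup_mono fun u hu => ?_
    exact v.2.symm.le.trans (List.IsPrefix.length_le hu)

theorem iIndepFun_children (hξ : ∀ v, Measurable (ξ v)) (hi : iIndepFun ξ P)
    (hY : ∀ v, Measurable[subtreeSigma ξ v] (Y v)) (v : Vertex) :
    iIndepFun (fun j : ℕ => Y (v ++ [j])) P :=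
  (iIndepFun_level hξ hi hY (v.length + 1)).precomp
    (g := fun j : ℕ => (⟨v ++ [j], by simp⟩ : {w : Vertex // w.length = v.length + 1}))
    fun i j h => by simpa using congrArg Subtype.val h

theorem indepFun_innovation_children (hξ : ∀ v, Measurable (ξ v)) (hi : iIndepFun ξ P)
    (hY : ∀ v, Measurable[subtreeSigma ξ v] (Y v)) (v : Vertex) :
    IndepFun (ξ v) (fun ω (j : ℕ) => Y (v ++ [j]) ω) P := by
  have h := (indepFun_level_innovation hξ hi hY (v.length + 1)).symm
  exact h.comp
    (φ := fun (f : {u : Vertex // u.length < v.length + 1} → E) => f ⟨v, Nat.lt_succ_self _⟩)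
    (ψ := fun (f : {w : Vertex // w.length = v.length + 1} → S) (j : ℕ) => f ⟨v ++ [j], by simp⟩)
    (measurable_pi_apply _) (measurable_pi_lambda _ fun _ => measurable_pi_apply _)

end Independence

theorem measurable_treeIter {Ω : Type*} {m : MeasurableSpace Ω} {ξ : Vertex → Ω → (ℕ → ℝ)}
    (n : ℕ) (v : Vertex) (h : ∀ u, v <+: u → Measurable (ξ u)) :
    Measurable fun ω => treeIter (fun u => ξ u ω) n v := by
  induction n generalizing v with
  | zero => exact measurable_const
  | succ n ih =>
    refine measurable_edgeCoverMap.comp ((h v List.prefix_rfl).prodMk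
      (measurable_pi_lambda _ fun j => ih _ fun u hu => h u ?_))
    exact (List.prefix_append v [j]).trans hu

theorem measurable_treeLimit {Ω : Type*} {m : MeasurableSpace Ω} {ξ : Vertex → Ω → (ℕ → ℝ)}
    (v : Vertex) (h : ∀ u, v <+: u → Measurable (ξ u)) :
    Measurable fun ω => treeLimit (fun u => ξ u ω) v :=
  Measurable.iSup fun _ => measurable_treeIter _ v h

section Laws

variable {Ω : Type*} [MeasurableSpace Ω] {P : Measure Ω} [IsProbabilityMeasure P]
  {ξ : Vertex → Ω → (ℕ → ℝ)} {Y : Vertex → Ω → ℝ≥0}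

theorem map_edgeCoverMap_children (hξ : ∀ v, Measurable (ξ v)) (hi : iIndepFun ξ P)
    (hlaw : ∀ v, P.map (ξ v) = poissonPointsLaw)
    (hY : ∀ v, Measurable[subtreeSigma ξ v] (Y v)) {c : ℝ} (h0 : 0 ≤ c) (h1 : c ≤ 1)
    (hYlaw : ∀ v, P.map (Y v) = expMixture c) (v : Vertex) :
    P.map (fun ω => edgeCoverMap (ξ v ω) (fun j => Y (v ++ [j]) ω))
      = expMixture (Real.exp (-c)) := by
  have hle : ∀ v, subtreeSigma ξ v ≤ ‹MeasurableSpace Ω› := fun v =>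
    iSup₂_le fun u _ => (hξ u).comap_le
  have hYm : ∀ v, Measurable (Y v) := fun v => (hY v).mono (hle v) le_rfl
  have hch : Measurable fun ω (j : ℕ) => Y (v ++ [j]) ω :=
    measurable_pi_lambda _ fun j => hYm _
  have h := (indepFun_iff_map_prod_eq_prod_map_map (hξ v).aemeasurable hch.aemeasurable).1
    (indepFun_innovation_children hξ hi hY v)
  rw [(iIndepFun_children hξ hi hY v).map_fun_eq_infinitePi_map fun j => hYm _, hlaw] at h
  simp_rw [hYlaw] at h
  rw [← map_edgeCoverMap h0 h1, ← h, Measure.map_map measurable_edgeCoverMap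
    ((hξ v).prodMk hch)]
  rfl

theorem map_treeIter (hξ : ∀ v, Measurable (ξ v)) (hi : iIndepFun ξ P)
    (hlaw : ∀ v, P.map (ξ v) = poissonPointsLaw) (n : ℕ) (v : Vertex) :
    P.map (fun ω => treeIter (fun u => ξ u ω) n v) = expMixture (weight n) := by
  induction n generalizing v with
  | zero => simp [treeIter, weight, expMixture_zero]
  | succ n ih =>
    refine map_edgeCoverMap_children hξ hi hlaw
      (Y := fun v ω => treeIter (fun u => ξ u ω) n v) (fun v => ?_) (weight_nonneg n)
      (weight_le_one n) ih v
    exact measurable_treeIter n v fun u hu => measurable_biSup_comap ξ hu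

theorem map_treeLimit (hξ : ∀ v, Measurable (ξ v)) (hi : iIndepFun ξ P)
    (hlaw : ∀ v, P.map (ξ v) = poissonPointsLaw) (v : Vertex) :
    P.map (fun ω => treeLimit (fun u => ξ u ω) v) = muStar := by
  have hm := measurable_treeLimit v fun u _ => hξ u
  have hmk := fun k => measurable_treeIter (2 * k) v fun u _ => hξ u
  have := Measure.isProbabilityMeasure_map (μ := P) hm.aemeasurable
  refine Measure.ext_of_Iic _ _ fun y => ?_
  rw [Measure.map_apply hm measurableSet_Iic, muStar_eq_expMixture,
    expMixture_Iic (lambertW_spec zero_le_one).1 lambertW_one_le_one]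
  have hset : (fun ω => treeLimit (fun u => ξ u ω) v) ⁻¹' Iic y
      = ⋂ k, (fun ω => treeIter (fun u => ξ u ω) (2 * k) v) ⁻¹' Iic y := by
    ext ω
    simp only [mem_preimage, mem_Iic, mem_iInter]
    exact ciSup_le_iff (bddAbove_treeIter_even _ v)
  have hanti : Antitone fun k =>
      (fun ω => treeIter (fun u => ξ u ω) (2 * k) v) ⁻¹' Iic y := fun k l hkl ω hω =>
    (treeIter_even_mono _ v hkl).trans hω
  rw [hset]
  refine tendsto_nhds_unique (tendsto_measure_iInter_atTop
    (fun k => (hmk k measurableSet_Iic).nullMeasurableSet) hanti ⟨0, measure_ne_top _ _⟩) ?_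
  have hval : ∀ k, P ((fun ω => treeIter (fun u => ξ u ω) (2 * k) v) ⁻¹' Iic y)
      = ENNReal.ofReal (1 - weight (2 * k) * Real.exp (-(y : ℝ))) := fun k => by
    rw [← Measure.map_apply (hmk k) measurableSet_Iic, map_treeIter hξ hi hlaw,
      expMixture_Iic (weight_nonneg _) (weight_le_one _)]
  simp only [Function.comp_def, hval]
  refine ENNReal.tendsto_ofReal (tendsto_const_nhds.sub (Tendsto.mul_const _ ?_))
  exact tendsto_weight.comp (tendsto_id.const_mul_atTop' two_pos)

end Laws

/-! ### Existence and endogeny -/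

/-- On the canonical space of the innovations, the limits of the iterates of even order form an
invariant recursive tree process. -/
theorem isInvariantRTP_treeLimit :
    IsInvariantRTP (Measure.infinitePi fun _ : Vertex => poissonPointsLaw) poissonPointsLaw
      edgeCoverMap muStar (fun v pts => pts v) (fun v pts => treeLimit pts v) := by
  set P := Measure.infinitePi fun _ : Vertex => poissonPointsLaw
  let ξ : Vertex → (Vertex → ℕ → ℝ) → ℕ → ℝ := fun v pts => pts v
  have hξ : ∀ v, Measurable (ξ v) := fun v => measurable_pi_apply v
  have hi : iIndepFun ξ P :=
    iIndepFun_infinitePi (P := fun _ : Vertex => poissonPointsLaw) (X := fun _ x => x)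
      fun _ => measurable_id
  have hlaw : ∀ v, P.map (ξ v) = poissonPointsLaw := fun v => Measure.infinitePi_map_eval _ v
  have hX : ∀ v, Measurable (fun pts => treeLimit pts v) := fun v =>
    measurable_treeLimit (ξ := ξ) v fun u _ => hξ u
  have hsub : ∀ v, Measurable[subtreeSigma ξ v] (fun pts => treeLimit pts v) := fun v =>
    measurable_treeLimit (ξ := ξ) v fun u hu => measurable_biSup_comap ξ hu
  have hXlaw : ∀ v, P.map (fun pts => treeLimit pts v) = muStar := fun v =>
    map_treeLimit (ξ := ξ) hξ hi hlaw v
  refine ⟨hξ, hX, hlaw, hi, fun v => ?_, hXlaw, iIndepFun_level hξ hi hsub,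
    indepFun_level_innovation hξ hi hsub⟩
  have hg : P.map (fun pts => edgeCoverMap (pts v) fun j => treeLimit pts (v ++ [j]))
      = muStar := by
    rw [muStar_eq_expMixture, ← exp_neg_lambertW_one]
    exact map_edgeCoverMap_children hξ hi hlaw hsub (lambertW_spec zero_le_one).1
      lambertW_one_le_one hXlaw v
  refine ae_eq_of_ae_le_of_map_eq (hX v) ?_
    (Eventually.of_forall fun pts => treeLimit_le_edgeCoverMap pts v) ((hXlaw v).trans hg.symm)
  exact measurable_edgeCoverMap.comp ((hξ v).prodMk (measurable_pi_lambda _ fun j => hX _))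

/-- The value of any invariant recursive tree process at the root lies above the limit of the
iterates of even order, and has the same law. -/
theorem IsInvariantRTP.root_ae_eq_treeLimit {Ω : Type*} [MeasurableSpace Ω] {P : Measure Ω}
    [IsProbabilityMeasure P] {ξ : Vertex → Ω → (ℕ → ℝ)} {X : Vertex → Ω → ℝ≥0}
    (h : IsInvariantRTP P poissonPointsLaw edgeCoverMap muStar ξ X) :
    X [] =ᵐ[P] fun ω => treeLimit (fun u => ξ u ω) [] := by
  symm
  refine ae_eq_of_ae_le_of_map_eq (measurable_treeLimit _ fun u _ => h.measurable_innovation u)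
    (h.measurable_value []) ?_ ?_
  · filter_upwards [ae_all_iff.2 h.recursion] with ω hω
    exact ciSup_le' fun k => treeIter_even_le (x := fun v => X v ω) hω k []
  · rw [map_treeLimit h.measurable_innovation h.iIndep_innovation h.law_innovation, h.law_value]

end EdgeCover

theorem mainTheorem7 :
    (∃ (Ω : Type) (_ : MeasurableSpace Ω) (P : Measure Ω) (_ : IsProbabilityMeasure P)
      (ξ : EdgeCover.Vertex → Ω → (ℕ → ℝ)) (X : EdgeCover.Vertex → Ω → ℝ≥0),
      EdgeCover.IsInvariantRTP P EdgeCover.poissonPointsLaw EdgeCover.edgeCoverMap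
        EdgeCover.muStar ξ X) ∧
    (∀ {Ω : Type*} [MeasurableSpace Ω] (P : Measure Ω) [IsProbabilityMeasure P]
      (ξ : EdgeCover.Vertex → Ω → (ℕ → ℝ)) (X : EdgeCover.Vertex → Ω → ℝ≥0),
      EdgeCover.IsInvariantRTP P EdgeCover.poissonPointsLaw EdgeCover.edgeCoverMap
        EdgeCover.muStar ξ X →
      EdgeCover.IsEndogenous P ξ X) := by
  refine ⟨⟨_, _, _, EdgeCover.isInvariantRTP_treeLimit.iIndep_innovation.isProbabilityMeasure,
    _, _, EdgeCover.isInvariantRTP_treeLimit⟩, fun {Ω} _ P _ ξ X h => ?_⟩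
  refine ⟨fun ω => EdgeCover.treeLimit (fun u => ξ u ω) [], ?_, h.root_ae_eq_treeLimit⟩
  exact EdgeCover.measurable_treeLimit _ fun u _ => measurable_iff_comap_le.2
    (le_iSup (fun v => MeasurableSpace.comap (ξ v) inferInstance) u)
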